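/- **Classical circuits.** A classical circuit is a finite directed acyclic graph whose in-degree-zero vertices are the input bits, whose out-degree-zero vertices are the output bits, and in which each vertex of in-degree $k>0$ carries a gate $\{0,1\}^k\to\{0,1\}$, whose value is copied to all outgoing edges; its fan-in is the maximal in-degree, and its depth is the maximal number of gates on a path from an input to an output. In a classical probabilistic circuit $\mathcal C$ for a problem with $N$ instance bits and $M$ solution bits, the input bits are the $N$ instance bits together with finitely many random bits, drawn from an arbitrary joint distribution independent of the instance; $M$ of the output bits form the solution and the other output bits are ignored. **The 1D Magic Square Problem.** Let $n\ge 2$. The input is $z_{in}=(\alpha_1,\dots,\alpha_n,\beta_1,\dots,\beta_n)$ with $\alpha_i,\beta_i\in\{0,1\}^2$. Consider $4n$ qubits $p_1,q_1,\dots,p_{2n},q_{2n}$, initially in $|0^{4n}\rangle$, and apply in this order: 1. $H$ to $p_{2i-1}$ and to $q_{2i-1}$, for $1\le i\le n$; 2. $\mathrm{CNOT}$ with control $p_{2i-1}$ and target $p_{2i}$, and $\mathrm{CNOT}$ with control $q_{2i-1}$ and target $q_{2i}$, for $1\le i\le n$; 3. $U(\alpha_i)$ to $(p_{2i-1},q_{2i-1})$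 and $V(\beta_i)$ to $(p_{2i},q_{2i})$, for $1\le i\le n$; 4. $W(\beta_i,\alpha_{i+1})$ to $(p_{2i},q_{2i},p_{2i+1},q_{2i+1})$, for $1\le i\le n-1$. Here (operator products act from right to left, and the first qubit is the control of $\mathrm{CNOT}$) $$U(00)=V(00)=I,\quad U(01)=H_1,\quad U(10)=H_1\,\mathrm{SWAP},\quad U(11)=H_1\,\mathrm{CNOT},$$ $$V(01)=H_1H_2,\quad V(10)=\mathrm{SWAP},\quad V(11)=(H_1H_2)\,\mathrm{CZ}\,(Z_1Z_2),$$ $W(00,00)=M_{13}\otimes M_{24}$ with $M=(H\otimes I)\,\mathrm{CNOT}$, and $W(\beta,\alpha)=I$ otherwise. Let $C_{z_{in}}$ be the resulting unitary. A string $z_{out}=(\mathbf x_1,\dots,\mathbf x_n,\mathbf y_1,\dots,\mathbf y_n)\in\{0,1\}^{4n}$, where $\mathbf x_i\in\{0,1\}^2$ are the outcomes of measuring $(p_{2i-1},q_{2i-1})$ and $\mathbf y_i\in\{0,1\}^2$ those of $(p_{2i},q_{2i})$ in the computational basis, is a solution for $z_{in}$ if $|\langle z_{out}|C_{z_{in}}|0^{4n}\rangle|^2>0$.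 Let $S\subseteq\{0,1\}^{4n}$ be the set of inputs for which there are $1\le j<k\le n$ and $\alpha,\beta\in\{01,10,11\}$ with $\alpha_j=\alpha$, $\alpha_i=00$ for $i\ne j$, $\beta_k=\beta$, and $\beta_i=00$ for $i\ne k$. **Theorem.** Let $n\ge 2$ and $K\ge 2$ be integers, and let $\mathcal C$ be a classical probabilistic circuit composed of gates of fan-in at most $K$ which, given a uniformly random input from $S$, produces a solution of the corresponding instance of the 1D Magic Square Problem with probability at least $9/10$ (over both the choice of the input and the random bits of $\mathcal C$). Then $$\mathrm{depth}(\mathcal C)\ \ge\ \frac{\log(0.00001\,n)}{2\log K}.$$ -/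

import Mathlib

noncomputable section

/-! ## Classical (probabilistic) circuits -/

/-- A classical Boolean circuit whose input bits are indexed by `I` and whose output bits are
indexed by `O`: a finite directed acyclic (multi)graph on the vertex set `V`. The vertex `v` has
in-degree `fanIn v`, its incoming edges start at `pred v 0, pred v 1, …`. The in-degree-zero
vertices are the input bits, the out-degree-zero vertices are the output bits, and every vertex of
positive in-degree carries a gate. -/
structure ClassicalCircuit (I O : Type) where
  V : Type
  [fintypeV : Fintype V]
  fanIn : V → ℕ
  pred : (v : V) → Fin (fanIn v) → V
  /-- The gate at `v` (irrelevant when `fanIn v = 0`). -/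
  gate : (v : V) → (Fin (fanIn v) → Bool) → Bool
  acyclic : ∀ v, ¬ Relation.TransGen (fun u w => ∃ i, pred w i = u) v v
  inputs : I ≃ {v : V // fanIn v = 0}
  outputs : O ≃ {v : V // ∀ w i, pred w i ≠ v}

namespace ClassicalCircuit

variable {I O : Type} (C : ClassicalCircuit I O)

/-- There is an edge from `u` to `w`. -/
def Edge (u w : C.V) : Prop := ∃ i, C.pred w i = u

theorem wellFounded_edge : WellFounded C.Edge := by
  have := C.fintypeV
  have : Std.Irrefl (Relation.TransGen C.Edge) := ⟨C.acyclic⟩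
  have h : WellFounded (Relation.TransGen C.Edge) :=
    Finite.wellFounded_of_trans_of_irrefl _
  exact Subrelation.wf (fun h => Relation.TransGen.single h) h

/-- The bit carried by each vertex when the circuit is run on the input string `x`. -/
def value (x : I → Bool) : C.V → Bool :=
  C.wellFounded_edge.fix fun v ih =>
    if h : C.fanIn v = 0 then x (C.inputs.symm ⟨v, h⟩)
    else C.gate v fun i => ih (C.pred v i) ⟨i, rfl⟩

/-- The Boolean function computed by the circuit. -/
def eval (x : I → Bool) : O → Bool := fun o => C.value x (C.outputs o).1

theorem value_input (x : I → Bool) (i : I) : C.value x (C.inputs i).1 = x i := by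
  rw [value, WellFounded.fix_eq, dif_pos (C.inputs i).2]
  simp

theorem value_gate (x : I → Bool) (v : C.V) (h : C.fanIn v ≠ 0) :
    C.value x v = C.gate v fun i => C.value x (C.pred v i) := by
  rw [value, WellFounded.fix_eq, dif_neg h]

/-- `C.PathFromInput v m`: there is a path from an input vertex to `v` that contains exactly
`m` gates (the gate at `v`, if any, included). -/
inductive PathFromInput : C.V → ℕ → Prop
  | input (v : C.V) (h : C.fanIn v = 0) : PathFromInput v 0
  | gate (v : C.V) (i : Fin (C.fanIn v)) (m : ℕ) (h : PathFromInput (C.pred v i) m) :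
      PathFromInput v (m + 1)

/-- The depth: the maximal number of gates along a path from an input to an output. -/
def depth : ℕ := sSup {m | ∃ o : O, C.PathFromInput (C.outputs o).1 m}

/-- The supremum that defines the depth is over a bounded set of natural numbers. -/
theorem bddAbove_paths : BddAbove {m | ∃ o : O, C.PathFromInput (C.outputs o).1 m} := by
  have := C.fintypeV
  have key : ∀ v, ∃ B, ∀ m, C.PathFromInput v m → m ≤ B := by
    intro v
    induction v using C.wellFounded_edge.induction with
    | _ v ih =>
      choose B hB using fun i => ih (C.pred v i) ⟨i, rfl⟩
      refine ⟨Finset.univ.sup B + 1, fun m hm => ?_⟩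
      cases hm with
      | input _ h => exact Nat.zero_le _
      | gate _ i m h =>
        exact Nat.succ_le_succ ((hB i m h).trans (Finset.le_sup (Finset.mem_univ i)))
  choose B hB using key
  refine ⟨Finset.univ.sup B, ?_⟩
  rintro m ⟨o, ho⟩
  exact (hB _ m ho).trans (Finset.le_sup (Finset.mem_univ _))

/-- All gates have fan-in at most `K`. -/
def FanInAtMost (K : ℕ) : Prop := ∀ v, C.fanIn v ≤ K

end ClassicalCircuit

/-- A classical probabilistic circuit for problems with instances in `I → Bool` and solutions in
`O → Bool`: a classical circuit with `r` further input bits, which are drawn from an arbitrary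
joint distribution that does not depend on the instance, and `w` further output bits, which are
ignored. -/
structure ProbabilisticCircuit (I O : Type) where
  r : ℕ
  w : ℕ
  circuit : ClassicalCircuit (I ⊕ Fin r) (O ⊕ Fin w)
  randomness : PMF (Fin r → Bool)

namespace ProbabilisticCircuit

variable {I O : Type} (C : ProbabilisticCircuit I O)

/-- The output on the instance `z` when the random input bits are `ρ`. -/
def run (z : I → Bool) (ρ : Fin C.r → Bool) : O → Bool :=
  fun o => C.circuit.eval (Sum.elim z ρ) (Sum.inl o)

open Classical in
/-- The probability that the input-output pair satisfies the relation `R`, for an instance chosen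
uniformly from `S` and independent random input bits. -/
def successProb (S : Finset (I → Bool)) (R : (I → Bool) → (O → Bool) → Prop) : ℝ :=
  (∑ z ∈ S, ∑ ρ : Fin C.r → Bool, if R z (C.run z ρ) then (C.randomness ρ).toReal else 0) / S.card

end ProbabilisticCircuit

/-! ## The 1D Magic Square Problem -/

namespace MagicSquare

/-- Operators on the state space of the qubits `Q`, as matrices in the computational basis. -/
abbrev Op (Q : Type) := Matrix (Q → Bool) (Q → Bool) ℂ

open Classical in
/-- The operator on the qubits `Q` that acts as the `k`-qubit gate `G` on the (distinct) qubits
`e 0, …, e (k - 1)`, in this order, and as the identity on all other qubits. -/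
def onQubits {Q : Type} {k : ℕ} (e : Fin k → Q) (G : Op (Fin k)) : Op Q :=
  Matrix.of fun z z' =>
    if ∀ q, q ∉ Set.range e → z q = z' q then G (fun i => z (e i)) (fun i => z' (e i)) else 0

/-- The Hadamard gate. -/
def gateH : Op (Fin 1) :=
  Matrix.of fun z z' => ((1 / Real.sqrt 2 : ℝ) : ℂ) * if z 0 && z' 0 then -1 else 1

/-- The Pauli `Z` gate. -/
def gateZ : Op (Fin 1) := Matrix.diagonal fun z => if z 0 then -1 else 1

/-- `CNOT |a b⟩ = |a, a ⊕ b⟩`. -/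
def gateCNOT : Op (Fin 2) :=
  Matrix.of fun z z' => if z 0 = z' 0 ∧ z 1 = xor (z' 0) (z' 1) then 1 else 0

/-- `SWAP |a b⟩ = |b a⟩`. -/
def gateSWAP : Op (Fin 2) :=
  Matrix.of fun z z' => if z 0 = z' 1 ∧ z 1 = z' 0 then 1 else 0

/-- `CZ = diag(1, 1, 1, -1)`. -/
def gateCZ : Op (Fin 2) := Matrix.diagonal fun z => if z 0 && z 1 then -1 else 1

/-- The controlled Clifford gate `U(γ)`, where `γ = (γ 0)(γ 1)` is a two-bit string. -/
def gateU (γ : Fin 2 → Bool) : Op (Fin 2) :=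
  match γ 0, γ 1 with
  | false, false => 1
  | false, true => onQubits ![0] gateH
  | true, false => onQubits ![0] gateH * gateSWAP
  | true, true => onQubits ![0] gateH * gateCNOT

/-- The controlled Clifford gate `V(γ)`. -/
def gateV (γ : Fin 2 → Bool) : Op (Fin 2) :=
  match γ 0, γ 1 with
  | false, false => 1
  | false, true => onQubits ![0] gateH * onQubits ![1] gateH
  | true, false => gateSWAP
  | true, true =>
      (onQubits ![0] gateH * onQubits ![1] gateH) * gateCZ *
        (onQubits ![0] gateZ * onQubits ![1] gateZ)

/-- The Bell basis change `M = (H ⊗ I) CNOT`. -/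
def gateM : Op (Fin 2) := onQubits ![0] gateH * gateCNOT

/-- The two-bit string `00`. -/
def zeroZero : Fin 2 → Bool := fun _ => false

/-- The controlled Clifford gate `W(β, α)`: it is `M₁₃ ⊗ M₂₄` if `α = β = 00`, and the identity
otherwise. -/
def gateW (β α : Fin 2 → Bool) : Op (Fin 4) :=
  if α = zeroZero ∧ β = zeroZero then onQubits ![0, 2] gateM * onQubits ![1, 3] gateM else 1

/-- Indices of the `4n` input bits, of the `4n` data qubits, and of the `4n` output bits
(with `i : Fin n` for the position `i + 1`).
Input bits: `(0, i, b)` is bit `b` of `α_i` and `(1, i, b)` is bit `b` of `β_i`.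
Data qubits: `(0, i, 0)`, `(0, i, 1)` are `p_{2i-1}`, `q_{2i-1}`; `(1, i, 0)`, `(1, i, 1)` are
`p_{2i}`, `q_{2i}` (positions counted from 1).
Output bits: each is the measurement outcome of the data qubit with the same index, so `(0, i, b)`
is bit `b` of `x_i` and `(1, i, b)` is bit `b` of `y_i`. -/
abbrev Idx (n : ℕ) := Fin 2 × Fin n × Fin 2

/-- The string `α_i` of the input `z`. -/
def alphaOf {n : ℕ} (z : Idx n → Bool) (i : Fin n) : Fin 2 → Bool := fun b => z (0, i, b)

/-- The string `β_i` of the input `z`. -/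
def betaOf {n : ℕ} (z : Idx n → Bool) (i : Fin n) : Fin 2 → Bool := fun b => z (1, i, b)

/-- Apply one gate per position; these gates act on disjoint sets of qubits, so that their order
does not matter. -/
def layer {n : ℕ} (g : Fin n → Op (Idx n)) : Op (Idx n) := ((List.finRange n).map g).prod

/-- Hadamard gates on all `p_{2i-1}`, `q_{2i-1}`. -/
def layerH (n : ℕ) : Op (Idx n) :=
  layer fun i => onQubits ![(0, i, 0)] gateH * onQubits ![(0, i, 1)] gateH

/-- CNOT gates with control `p_{2i-1}` and target `p_{2i}`, and with control `q_{2i-1}` and target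
`q_{2i}`. -/
def layerCNOT (n : ℕ) : Op (Idx n) :=
  layer fun i => onQubits ![(0, i, 0), (1, i, 0)] gateCNOT *
    onQubits ![(0, i, 1), (1, i, 1)] gateCNOT

/-- `U(α_i)` on `p_{2i-1} q_{2i-1}` and `V(β_i)` on `p_{2i} q_{2i}`. -/
def layerUV {n : ℕ} (z : Idx n → Bool) : Op (Idx n) :=
  layer fun i => onQubits ![(0, i, 0), (0, i, 1)] (gateU (alphaOf z i)) *
    onQubits ![(1, i, 0), (1, i, 1)] (gateV (betaOf z i))

/-- `W(β_i, α_{i+1})` on `p_{2i} q_{2i} p_{2i+1} q_{2i+1}`, for all `i` that have a successor. -/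
def layerW {n : ℕ} (z : Idx n → Bool) : Op (Idx n) :=
  layer fun i =>
    if h : i.val + 1 < n then
      onQubits ![(1, i, 0), (1, i, 1), (0, ⟨i.val + 1, h⟩, 0), (0, ⟨i.val + 1, h⟩, 1)]
        (gateW (betaOf z i) (alphaOf z ⟨i.val + 1, h⟩))
    else 1

/-- The Clifford unitary of the quantum circuit on the input `z` (first layer on the right). -/
def circuitUnitary {n : ℕ} (z : Idx n → Bool) : Op (Idx n) :=
  layerW z * layerUV z * layerCNOT n * layerH n

/-- The 1D Magic Square Relation: the circuit with input `zin`, started in the all-zero state and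
measured in the computational basis, yields `zout` with nonzero probability. -/
def Relation {n : ℕ} (zin zout : Idx n → Bool) : Prop :=
  0 < ‖circuitUnitary zin zout (fun _ => false)‖ ^ 2

/-- The input with `α_j = α`, `β_k = β` and all other `α_i`, `β_i` equal to `00`. -/
def inputOf {n : ℕ} (j k : Fin n) (α β : Fin 2 → Bool) : Idx n → Bool := fun q =>
  if q.1 = 0 then (if q.2.1 = j then α q.2.2 else false)
  else (if q.2.1 = k then β q.2.2 else false)

open Classical in
/-- The set `S` of inputs given by `j < k` and `α, β ∈ {01, 10, 11}`. -/
def inputSet (n : ℕ) : Finset (Idx n → Bool) :=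
  Finset.univ.filter fun z => ∃ j k : Fin n, ∃ α β : Fin 2 → Bool,
    j < k ∧ α ≠ zeroZero ∧ β ≠ zeroZero ∧ z = inputOf j k α β

end MagicSquare

end

/-! On the input with `α_j = code s` and `β_k = code t` the quantum circuit plays the Mermin–Peres
magic square game. Bell measurements between positions `j` and `k` swap entanglement along the
chain, after which the gate at `j` measures row `s` and the gate at `k` measures column `t`, up to
Pauli corrections recorded in the intermediate outcomes.

In stabilizer language: place the Pauli `squarePauli s t` on both ends of each Bell pair at
positions `j, …, k`. This fixes the Bell pairs up to sign, and the remaining layers turn it into a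
product of `Z`s. A nonzero amplitude therefore forces one parity of the output bits, with sign `-1`
exactly in the last column (`Relation.parity`). If every output bit depends on only one of `s` and
`t`, with `x_j` depending on `s` and `y_k` on `t`, then the product of the nine constraints reads
`-1 = 1` (`not_forall_relation`). So at most 8 of the 9 inputs for such `j`, `k` are solved.

Each output bit of the classical circuit sees at most `M = K ^ depth` instance bits, so all but `12
n M²` pairs of positions have this independence (`card_not_separated_le`). Since `9/10 > 8/9`,
success forces `M²` to grow linearly in `n`; taking logarithms gives the bound. -/

noncomputable section

namespace MagicSquare

/-! ## Clifford covariance -/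

/-- The sign `(-1)^b`. -/
def sgn (b : Bool) : ℂ := if b then -1 else 1

@[simp] theorem sgn_false : sgn false = 1 := rfl

@[simp] theorem sgn_true : sgn true = -1 := rfl

theorem sgn_mul_self (b : Bool) : sgn b * sgn b = 1 := by cases b <;> simp

variable {Q : Type}

/-- A Pauli string on the qubits `Q` (up to sign): at `q` it is `X ^ (f q).1 * Z ^ (f q).2`. -/
abbrev PauliString (Q : Type) := Q → Bool × Bool

/-- The action of the `X` part of a Pauli string on basis states. -/
def PauliString.shift (f : PauliString Q) (z : Q → Bool) : Q → Bool := fun q => xor (z q) (f q).1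

theorem PauliString.shift_shift (f : PauliString Q) (z : Q → Bool) : f.shift (f.shift z) = z := by
  funext q; simp [shift]

/-- The eigenvalue of the `Z` part of a Pauli string on a basis state. -/
def PauliString.phase [Fintype Q] (f : PauliString Q) (z : Q → Bool) : ℂ :=
  ∏ q, sgn ((f q).2 && z q)

theorem PauliString.phase_mul_self [Fintype Q] (f : PauliString Q) (z : Q → Bool) :
    f.phase z * f.phase z = 1 := by
  simp [phase, ← Finset.prod_mul_distrib, sgn_mul_self]

/-- Conjugation by `G` maps the Pauli string `f` to `c` times the Pauli string `f'`. -/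
def PauliCov [Fintype Q] (G : Op Q) (f f' : PauliString Q) (c : ℂ) : Prop :=
  ∀ z z', G (f'.shift z) (f.shift z') = c * f'.phase z * f.phase z' * G z z'

theorem PauliCov.one [Fintype Q] (f : PauliString Q) : PauliCov 1 f f 1 := by
  intro z z'
  have h : f.shift z = f.shift z' ↔ z = z' :=
    ⟨fun h => by rw [← f.shift_shift z, h, f.shift_shift], fun h => by rw [h]⟩
  by_cases hz : z = z'
  · subst hz; simp [f.phase_mul_self]
  · simp [h, hz]

variable [Fintype Q] [DecidableEq Q]

/-- With `P_f |z⟩ = f.phase z |f.shift z⟩`, covariance says `G P_f = c P_{f'} G` entry by entry, so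
it composes. Reindexing the intermediate basis states by `f'.shift` makes the phase of `f'` appear
twice and cancel. -/
theorem PauliCov.mul {G G' : Op Q} {f f' f'' : PauliString Q} {c c' : ℂ}
    (h' : PauliCov G' f' f'' c') (h : PauliCov G f f' c) : PauliCov (G' * G) f f'' (c' * c) := by
  intro z z'
  rw [Matrix.mul_apply, Matrix.mul_apply, Finset.mul_sum]
  let e : Equiv.Perm (Q → Bool) := ⟨f'.shift, f'.shift, f'.shift_shift, f'.shift_shift⟩
  rw [← Equiv.sum_comp e]
  refine Finset.sum_congr rfl fun w _ => ?_
  change G' _ (f'.shift w) * G (f'.shift w) _ = _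
  rw [h', h]
  linear_combination (c' * f''.phase z * G' z w * c * f.phase z' * G w z') * f'.phase_mul_self w

theorem PauliCov.onQubits {k : ℕ} {e : Fin k → Q} (he : Function.Injective e) {G : Op (Fin k)}
    {f f' : PauliString Q} {c : ℂ} (h : PauliCov G (fun i => f (e i)) (fun i => f' (e i)) c)
    (hf : ∀ q, q ∉ Set.range e → f q = f' q) : PauliCov (onQubits e G) f f' c := by
  classical
  intro z z'
  have h1 : (∀ q, q ∉ Set.range e → f'.shift z q = f.shift z' q) ↔
      ∀ q, q ∉ Set.range e → z q = z' q := by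
    refine forall₂_congr fun q hq => ?_
    simp [PauliString.shift, hf q hq]
  simp only [MagicSquare.onQubits, Matrix.of_apply, h1]
  split_ifs with hz
  -- Away from the range of `e` the two strings agree and so do `z` and `z'`; each such qubit
  -- contributes a squared sign.
  · have h2 : f'.phase z * f.phase z' =
        PauliString.phase (fun i => f' (e i)) (fun i => z (e i)) *
          PauliString.phase (fun i => f (e i)) (fun i => z' (e i)) := by
      simp only [PauliString.phase, ← Finset.prod_mul_distrib]
      rw [← Finset.prod_subset (Finset.subset_univ (Finset.univ.image e)),
        Finset.prod_image fun a _ b _ hab => he hab]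
      intro q _ hq
      have hq' : q ∉ Set.range e := by simpa using hq
      rw [hf q hq', hz q hq', sgn_mul_self]
    have := h (fun i => z (e i)) (fun i => z' (e i))
    rw [mul_assoc c, h2, ← mul_assoc]
    exact this
  · simp

/-- Gates acting on disjoint sets of qubits transform a Pauli string independently. -/
theorem PauliCov.onQubits_mul_onQubits {k l : ℕ} {e : Fin k → Q} {e' : Fin l → Q}
    (he : Function.Injective e) (he' : Function.Injective e') (hd : ∀ i j, e i ≠ e' j)
    {G : Op (Fin k)} {G' : Op (Fin l)} {f f' : PauliString Q} {c c' : ℂ}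
    (h : PauliCov G (fun i => f (e i)) (fun i => f' (e i)) c)
    (h' : PauliCov G' (fun i => f (e' i)) (fun i => f' (e' i)) c')
    (hf : ∀ q, q ∉ Set.range e → q ∉ Set.range e' → f q = f' q) :
    PauliCov (MagicSquare.onQubits e G * MagicSquare.onQubits e' G') f f' (c * c') := by
  classical
  -- The string after `G'` has acted but before `G` has.
  let m : PauliString Q := fun q => if q ∈ Set.range e' then f' q else f q
  have hm : ∀ i, m (e i) = f (e i) := fun i => if_neg (by rintro ⟨j, hj⟩; exact hd i j hj.symm)
  have hm' : ∀ i, m (e' i) = f' (e' i) := fun i => if_pos ⟨i, rfl⟩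
  refine PauliCov.mul (f' := m) (PauliCov.onQubits he (by simpa only [hm] using h) ?_)
    (PauliCov.onQubits he' (by simpa only [hm'] using h') ?_)
  · intro q hq
    by_cases hq' : q ∈ Set.range e'
    · exact if_pos hq'
    · exact (if_neg hq').trans (hf q hq hq')
  · exact fun q hq => (if_neg hq).symm

/-- Between gates the string is a hybrid, equal to `f'` on the blocks already treated and to `f`
elsewhere. Hence `hloc` is required for all `h`, `h'` that match `f`, `f'` on the block alone, and
`m` is kept general in the induction. -/
theorem PauliCov.list_prod {ι : Type} {g : ι → Op Q} {blk : ι → Set Q} {f f' : PauliString Q}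
    {c : ι → ℂ} (hdisj : ∀ i i' q, q ∈ blk i → q ∈ blk i' → i = i')
    (hloc : ∀ i h h', (∀ q ∈ blk i, h q = f q) → (∀ q ∈ blk i, h' q = f' q) →
      (∀ q, q ∉ blk i → h q = h' q) → PauliCov (g i) h h' (c i))
    (l : List ι) (hl : l.Nodup) {m : PauliString Q}
    (hm : ∀ i ∈ l, ∀ q ∈ blk i, m q = f' q) (hm' : ∀ q, (∀ i ∈ l, q ∉ blk i) → m q = f q) :
    PauliCov (l.map g).prod f m (l.map c).prod := by
  classical
  induction l generalizing m with
  | nil =>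
    obtain rfl : m = f := funext fun q => hm' q (by simp)
    simpa using PauliCov.one m
  | cons i l ih =>
    obtain ⟨hi, hl⟩ := List.nodup_cons.1 hl
    have hne : ∀ i' ∈ l, ∀ q ∈ blk i', q ∉ blk i := fun i' hi' q hq hq' =>
      hi (hdisj i i' q hq' hq ▸ hi')
    let p : PauliString Q := fun q => if q ∈ blk i then f q else m q
    simp only [List.map_cons, List.prod_cons]
    refine PauliCov.mul (f' := p) (hloc i p m (fun q hq => if_pos hq)
      (hm i (by simp)) fun q hq => if_neg hq) (ih hl ?_ ?_)
    · intro i' hi' q hq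
      exact (if_neg (hne i' hi' q hq)).trans (hm i' (by simp [hi']) q hq)
    · intro q hq
      by_cases hqi : q ∈ blk i
      · exact if_pos hqi
      · refine (if_neg hqi).trans (hm' q ?_)
        rintro i' hi'
        rcases List.mem_cons.1 hi' with rfl | hi'
        · exact hqi
        · exact hq i' hi'

/-- A layer of gates on disjoint blocks of qubits transforms a Pauli string blockwise. -/
theorem PauliCov.layer {n : ℕ} {g : Fin n → Op (Idx n)} (blk : Fin n → Set (Idx n))
    {f f' : PauliString (Idx n)} {c : Fin n → ℂ}
    (hdisj : ∀ i i' q, q ∈ blk i → q ∈ blk i' → i = i')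
    (hloc : ∀ i h h', (∀ q ∈ blk i, h q = f q) → (∀ q ∈ blk i, h' q = f' q) →
      (∀ q, q ∉ blk i → h q = h' q) → PauliCov (g i) h h' (c i))
    (hff' : ∀ q, (∀ i, q ∉ blk i) → f q = f' q) :
    PauliCov (layer g) f f' (∏ i, c i) := by
  have := PauliCov.list_prod hdisj hloc (List.finRange n) (List.nodup_finRange n) (m := f')
    (fun _ _ _ _ => rfl) (fun q hq => (hff' q fun i => hq i (List.mem_finRange i)).symm)
  rwa [← List.ofFn_eq_map (f := c), List.prod_ofFn] at this

/-! ## Covariance of the elementary gates -/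

/-- The sign comes from reordering: conjugation by `H` sends `XZ` to `ZX = -XZ`. -/
theorem pauliCov_gateH {f f' : PauliString (Fin 1)} (hf : f' 0 = (f 0).swap) :
    PauliCov gateH f f' (sgn ((f 0).1 && (f 0).2)) := by
  intro z z'
  simp only [PauliString.phase, PauliString.shift, gateH, Matrix.of_apply, Fin.prod_univ_one, hf]
  rcases f 0 with ⟨a, b⟩
  cases a <;> cases b <;> cases z 0 <;> cases z' 0 <;> simp

theorem pauliCov_gateZ {f f' : PauliString (Fin 1)} (hf : f' 0 = f 0) :
    PauliCov gateZ f f' (sgn (f 0).1) := by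
  obtain rfl : f' = f := by funext q; fin_cases q; exact hf
  intro z z'
  have h : f'.shift z = f'.shift z' ↔ z = z' :=
    ⟨fun h => by rw [← f'.shift_shift z, h, f'.shift_shift], fun h => by rw [h]⟩
  by_cases hz : z = z'
  · subst hz
    simp only [PauliString.phase, PauliString.shift, gateZ, Matrix.diagonal_apply_eq,
      Fin.prod_univ_one]
    change sgn (xor (z 0) (f' 0).1) = _ * _ * _ * sgn (z 0)
    rcases f' 0 with ⟨a, b⟩
    cases a <;> cases b <;> cases z 0 <;> simp
  · simp [gateZ, h, hz]

theorem pauliCov_gateCZ {f f' : PauliString (Fin 2)}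
    (h0 : f' 0 = ((f 0).1, xor (f 0).2 (f 1).1)) (h1 : f' 1 = ((f 1).1, xor (f 1).2 (f 0).1)) :
    PauliCov gateCZ f f' (sgn ((f 0).1 && (f 1).1)) := by
  intro z z'
  have hs : f'.shift = f.shift := by
    funext z q; fin_cases q <;> simp [PauliString.shift, h0, h1]
  have h : f.shift z = f.shift z' ↔ z = z' :=
    ⟨fun h => by rw [← f.shift_shift z, h, f.shift_shift], fun h => by rw [h]⟩
  rw [hs]
  by_cases hz : z = z'
  · subst hz
    simp only [PauliString.phase, PauliString.shift, gateCZ, Matrix.diagonal_apply_eq,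
      Fin.prod_univ_two, h0, h1]
    change sgn (xor (z 0) (f 0).1 && xor (z 1) (f 1).1) = _ * _ * _ * sgn (z 0 && z 1)
    rcases f 0 with ⟨a, b⟩
    rcases f 1 with ⟨a', b'⟩
    cases a <;> cases b <;> cases a' <;> cases b' <;> cases z 0 <;> cases z 1 <;> simp
  · simp [gateCZ, h, hz]

theorem pauliCov_gateCNOT {f f' : PauliString (Fin 2)}
    (h0 : f' 0 = ((f 0).1, xor (f 0).2 (f 1).2)) (h1 : f' 1 = (xor (f 0).1 (f 1).1, (f 1).2)) :
    PauliCov gateCNOT f f' 1 := by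
  intro z z'
  simp only [PauliString.phase, PauliString.shift, gateCNOT, Matrix.of_apply,
    Fin.prod_univ_two, h0, h1]
  rcases f 0 with ⟨a, b⟩
  rcases f 1 with ⟨a', b'⟩
  generalize z 0 = x, z 1 = y, z' 0 = x', z' 1 = y'
  revert a b a' b' x y x' y'
  simp [Bool.forall_bool]

theorem pauliCov_gateSWAP {f f' : PauliString (Fin 2)} (h0 : f' 0 = f 1) (h1 : f' 1 = f 0) :
    PauliCov gateSWAP f f' 1 := by
  intro z z'
  simp only [PauliString.phase, PauliString.shift, gateSWAP, Matrix.of_apply,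
    Fin.prod_univ_two, h0, h1]
  rcases f 0 with ⟨a, b⟩
  rcases f 1 with ⟨a', b'⟩
  generalize z 0 = x, z 1 = y, z' 0 = x', z' 1 = y'
  revert a b a' b' x y x' y'
  simp [Bool.forall_bool]


/-! ## The magic square -/

/-- The nonzero two-bit strings `01`, `10`, `11`. -/
def code : Fin 3 → Fin 2 → Bool := ![![false, true], ![true, false], ![true, true]]

/-- The nonzero linear forms on two-bit strings: first bit, second bit, sum. -/
def form : Fin 3 → Fin 2 → Bool := ![![true, false], ![false, true], ![true, true]]

/-- The two-qubit Pauli operator in row `s` and column `t` of the magic square. -/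
def squarePauli : Fin 3 → Fin 3 → PauliString (Fin 2) :=
  ![![![(true, false), (false, false)], ![(false, false), (false, true)],
      ![(true, false), (false, true)]],
    ![![(false, false), (true, false)], ![(false, true), (false, false)],
      ![(false, true), (true, false)]],
    ![![(true, false), (true, false)], ![(false, true), (false, true)],
      ![(true, true), (true, true)]]]

theorem code_ne_zeroZero (s : Fin 3) : code s ≠ zeroZero := by
  revert s; decide

theorem exists_code_eq {γ : Fin 2 → Bool} (h : γ ≠ zeroZero) : ∃ s, code s = γ := by
  revert γ; decide

theorem code_injective : Function.Injective code := by
  intro s t; revert s t; decide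

/-- The gate `H` on the first qubit exchanges `X` and `Z` there. -/
theorem pauliCov_onQubits_zero_gateH {f f' : PauliString (Fin 2)} (h0 : f' 0 = (f 0).swap)
    (h1 : f' 1 = f 1) : PauliCov (onQubits ![0] gateH) f f' (sgn ((f 0).1 && (f 0).2)) := by
  refine PauliCov.onQubits (Function.injective_of_subsingleton _)
    (pauliCov_gateH (f := fun i => f (![0] i)) h0) fun q hq => ?_
  fin_cases q
  · exact absurd ⟨0, rfl⟩ hq
  · exact h1.symm

theorem pauliCov_gateH_gateH {f f' : PauliString (Fin 2)} (h0 : f' 0 = (f 0).swap)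
    (h1 : f' 1 = (f 1).swap) : PauliCov (onQubits ![0] gateH * onQubits ![1] gateH) f f'
      (sgn ((f 0).1 && (f 0).2) * sgn ((f 1).1 && (f 1).2)) := by
  refine PauliCov.onQubits_mul_onQubits (Function.injective_of_subsingleton _)
    (Function.injective_of_subsingleton _) (by decide)
    (pauliCov_gateH (f := fun i => f (![0] i)) h0)
    (pauliCov_gateH (f := fun i => f (![1] i)) h1) fun q hq hq' => ?_
  fin_cases q
  · exact absurd ⟨0, rfl⟩ hq
  · exact absurd ⟨0, rfl⟩ hq'

theorem pauliCov_gateZ_gateZ (f : PauliString (Fin 2)) :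
    PauliCov (onQubits ![0] gateZ * onQubits ![1] gateZ) f f (sgn (f 0).1 * sgn (f 1).1) :=
  PauliCov.onQubits_mul_onQubits (Function.injective_of_subsingleton _)
    (Function.injective_of_subsingleton _) (by decide)
    (pauliCov_gateZ (f := fun i => f (![0] i)) rfl)
    (pauliCov_gateZ (f := fun i => f (![1] i)) rfl) fun _ _ _ => rfl

/-- `M` diagonalizes the Bell basis: `CNOT` sends `P ⊗ P` with `P = X^a Z^b` to `X^a ⊗ Z^b`, and `H`
turns the remaining `X` into `Z`. Equal Paulis on the two qubits are the only case that arises on a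
link. -/
theorem pauliCov_gateM {f f' : PauliString (Fin 2)} (h : f 1 = f 0)
    (h0 : f' 0 = (false, (f 0).1)) (h1 : f' 1 = (false, (f 0).2)) : PauliCov gateM f f' 1 := by
  have := (pauliCov_onQubits_zero_gateH (f := ![((f 0).1, false), (false, (f 0).2)]) (f' := f')
    (by simpa using h0) (by simpa using h1)).mul
    (pauliCov_gateCNOT (f := f) (by simp [h]) (by simp [h]))
  rw [gateM]
  simpa using this

theorem pauliCov_gateW {f f' : PauliString (Fin 4)} (h2 : f 2 = f 0) (h3 : f 3 = f 1)
    (h0' : f' 0 = (false, (f 0).1)) (h1' : f' 1 = (false, (f 1).1))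
    (h2' : f' 2 = (false, (f 0).2)) (h3' : f' 3 = (false, (f 1).2)) :
    PauliCov (gateW zeroZero zeroZero) f f' 1 := by
  rw [gateW, if_pos ⟨rfl, rfl⟩]
  have := PauliCov.onQubits_mul_onQubits (e := ![(0 : Fin 4), 2]) (e' := ![(1 : Fin 4), 3])
    (f := f) (f' := f') (by decide) (by decide) (by decide)
    (pauliCov_gateM h2 h0' h2') (pauliCov_gateM h3 h1' h3') fun q hq hq' => ?_
  · simpa using this
  · fin_cases q
    · exact absurd ⟨0, rfl⟩ hq
    · exact absurd ⟨0, rfl⟩ hq'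
    · exact absurd ⟨1, rfl⟩ hq
    · exact absurd ⟨1, rfl⟩ hq'

theorem PauliCov.of_eq {Q : Type} [Fintype Q] {G : Op Q} {f f' : PauliString Q} {c c' : ℂ}
    (h : PauliCov G f f' c) (hc : c = c') : PauliCov G f f' c' := hc ▸ h

/-- `U` diagonalizes each row of the magic square. -/
theorem pauliCov_gateU (s t : Fin 3) :
    PauliCov (gateU (code s)) (squarePauli s t) (fun b => (false, form t b)) 1 := by
  fin_cases s
  · refine (pauliCov_onQubits_zero_gateH (f := squarePauli 0 t)
      (f' := fun b => (false, form t b)) (by revert t; decide) (by revert t; decide)).of_eq ?_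
    fin_cases t <;> simp [squarePauli]
  · refine ((pauliCov_onQubits_zero_gateH (f := ![squarePauli 1 t 1, squarePauli 1 t 0])
      (f' := fun b => (false, form t b)) (by revert t; decide) (by revert t; decide)).mul
      (pauliCov_gateSWAP (f := squarePauli 1 t) rfl rfl)).of_eq ?_
    fin_cases t <;> simp [squarePauli]
  · refine ((pauliCov_onQubits_zero_gateH (f := ![(form t 0, false), (false, form t 1)])
      (f' := fun b => (false, form t b)) (by revert t; decide) (by revert t; decide)).mul
      (pauliCov_gateCNOT (f := squarePauli 2 t) (by revert t; decide) (by revert t; decide))).of_eq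
        ?_
    simp

/-- `V` diagonalizes each column of the magic square; the last column carries the sign. -/
theorem pauliCov_gateV (s t : Fin 3) :
    PauliCov (gateV (code t)) (squarePauli s t) (fun b => (false, form s b))
      (sgn (decide (t = 2))) := by
  fin_cases t
  · refine (pauliCov_gateH_gateH (f := squarePauli s 0) (f' := fun b => (false, form s b))
      (by revert s; decide) (by revert s; decide)).of_eq ?_
    fin_cases s <;> simp [squarePauli]
  · exact pauliCov_gateSWAP (f := squarePauli s 1) (f' := fun b => (false, form s b))
      (by revert s; decide) (by revert s; decide)
  -- In each row the total sign is `-1`. For `X ⊗ Z` and `Z ⊗ X` it comes from the `Z` gates, which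
  -- meet a single `X`; for `XZ ⊗ XZ` those signs cancel and `CZ` supplies it.
  · refine (((pauliCov_gateH_gateH (f := ![(form s 0, false), (form s 1, false)])
      (f' := fun b => (false, form s b)) rfl rfl).mul
      (pauliCov_gateCZ (f := squarePauli s 2) (by revert s; decide) (by revert s; decide))).mul
      (pauliCov_gateZ_gateZ (squarePauli s 2))).of_eq ?_
    fin_cases s <;> simp [squarePauli]

/-! ## Propagating a stabilizer through the circuit -/

section Propagation

variable {n : ℕ} (j k : Fin n) (s t : Fin 3)

/-- A stabilizer of the initial state. -/
def stabInit : PauliString (Idx n) := fun q =>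
  (false, if j ≤ q.2.1 ∧ q.2.1 ≤ k then
    if q.1 = 0 then (squarePauli s t q.2.2).1 else (squarePauli s t q.2.2).2 else false)

/-- The image of `stabInit` under the layer of Hadamard gates. -/
def stabH : PauliString (Idx n) := fun q =>
  if j ≤ q.2.1 ∧ q.2.1 ≤ k then
    if q.1 = 0 then ((squarePauli s t q.2.2).1, false) else (false, (squarePauli s t q.2.2).2)
  else (false, false)

/-- The image of `stabInit` once the Bell pairs are prepared. -/
def stabBell : PauliString (Idx n) := fun q =>
  if j ≤ q.2.1 ∧ q.2.1 ≤ k then squarePauli s t q.2.2 else (false, false)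

/-- The image of `stabInit` after the gates `U` and `V`. -/
def stabUV : PauliString (Idx n) := fun q =>
  if q.1 = 0 ∧ q.2.1 = j then (false, form t q.2.2)
  else if q.1 = 1 ∧ q.2.1 = k then (false, form s q.2.2)
  else stabBell j k s t q

/-- The bits of the output that enter the parity constraint. -/
def check : Idx n → Bool := fun q =>
  if q.1 = 0 then
    if q.2.1 = j then form t q.2.2
    else if j ≤ q.2.1 ∧ q.2.1 ≤ k then (squarePauli s t q.2.2).2 else false
  else
    if q.2.1 = k then form s q.2.2
    else if j ≤ q.2.1 ∧ q.2.1 ≤ k then (squarePauli s t q.2.2).1 else false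

/-- The block of qubits at a position. -/
def posBlock (i : Fin n) : Set (Idx n) := {q | q.2.1 = i}

theorem posBlock_disjoint (i i' : Fin n) (q : Idx n) (h : q ∈ posBlock i) (h' : q ∈ posBlock i') :
    i = i' := h.symm.trans h'

/-- The initial string is purely `Z`-type, as needed to fix the all-zero state, so the Hadamard
gates produce no sign. -/
theorem pauliCov_layerH : PauliCov (layerH n) (stabInit j k s t) (stabH j k s t) 1 := by
  have := PauliCov.layer (g := fun i : Fin n => onQubits ![(0, i, 0)] gateH *
    onQubits ![(0, i, 1)] gateH) (c := fun _ => 1) (f := stabInit j k s t) (f' := stabH j k s t)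
    posBlock posBlock_disjoint ?_ ?_
  · simpa [layerH] using this
  · intro i h h' hh hh' hne
    have e : ∀ b, h' (0, i, b) = (h (0, i, b)).swap := fun b => by
      rw [hh _ rfl, hh' _ rfl, stabH, stabInit]; split_ifs <;> simp_all
    have e1 : ∀ b, (h (0, i, b)).1 = false := fun b => by rw [hh _ rfl, stabInit]
    have := PauliCov.onQubits_mul_onQubits (e := ![((0, i, 0) : Idx n)]) (f := h) (f' := h')
      (e' := ![((0, i, 1) : Idx n)]) (Function.injective_of_subsingleton _)
      (Function.injective_of_subsingleton _) (by simp)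
      (pauliCov_gateH (e 0)) (pauliCov_gateH (e 1)) ?_
    · simpa [e1] using this
    · rintro ⟨a, i', b⟩ hq hq'
      by_cases hi : i' = i
      · subst hi
        have ha : a = 1 := by
          fin_cases a
          · fin_cases b
            · exact absurd ⟨0, rfl⟩ hq
            · exact absurd ⟨0, rfl⟩ hq'
          · rfl
        subst ha
        rw [hh _ rfl, hh' _ rfl, stabH, stabInit]; split_ifs <;> simp_all
      · exact hne _ hi
  · exact fun q hq => absurd rfl (hq q.2.1)

/-- `CNOT` copies `X` from control to target and `Z` from target to control, so `X^a ⊗ Z^b` becomes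
`X^a Z^b` on both ends of a Bell pair. -/
theorem pauliCov_layerCNOT : PauliCov (layerCNOT n) (stabH j k s t) (stabBell j k s t) 1 := by
  have := PauliCov.layer (g := fun i : Fin n => onQubits ![(0, i, 0), (1, i, 0)] gateCNOT *
    onQubits ![(0, i, 1), (1, i, 1)] gateCNOT) (c := fun _ => 1)
    (f := stabH j k s t) (f' := stabBell j k s t) posBlock posBlock_disjoint ?_ ?_
  · simpa [layerCNOT] using this
  · intro i h h' hh hh' hne
    have e0 : ∀ b, h' (0, i, b) = ((h (0, i, b)).1, xor (h (0, i, b)).2 (h (1, i, b)).2) :=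
      fun b => by
        rw [hh _ rfl, hh _ rfl, hh' _ rfl, stabH, stabH, stabBell]; split_ifs <;> simp_all
    have e1 : ∀ b, h' (1, i, b) = (xor (h (0, i, b)).1 (h (1, i, b)).1, (h (1, i, b)).2) :=
      fun b => by
        rw [hh _ rfl, hh _ rfl, hh' _ rfl, stabH, stabH, stabBell]; split_ifs <;> simp_all
    have := PauliCov.onQubits_mul_onQubits (e := ![((0, i, 0) : Idx n), (1, i, 0)]) (f := h)
      (f' := h') (e' := ![((0, i, 1) : Idx n), (1, i, 1)])
      (by intro x y; fin_cases x <;> fin_cases y <;> simp)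
      (by intro x y; fin_cases x <;> fin_cases y <;> simp)
      (by intro x y; fin_cases x <;> fin_cases y <;> simp)
      (pauliCov_gateCNOT (e0 0) (e1 0)) (pauliCov_gateCNOT (e0 1) (e1 1)) ?_
    · simpa using this
    · rintro ⟨a, i', b⟩ hq hq'
      by_cases hi : i' = i
      · subst hi
        fin_cases b <;> fin_cases a
        · exact absurd ⟨0, rfl⟩ hq
        · exact absurd ⟨1, rfl⟩ hq
        · exact absurd ⟨0, rfl⟩ hq'
        · exact absurd ⟨1, rfl⟩ hq'
      · exact hne _ hi
  · exact fun q hq => absurd rfl (hq q.2.1)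

theorem alphaOf_inputOf (α β : Fin 2 → Bool) (i : Fin n) :
    alphaOf (inputOf j k α β) i = if i = j then α else zeroZero := by
  funext b
  by_cases h : i = j <;> simp [alphaOf, inputOf, h, zeroZero]

theorem betaOf_inputOf (α β : Fin 2 → Bool) (i : Fin n) :
    betaOf (inputOf j k α β) i = if i = k then β else zeroZero := by
  funext b
  by_cases h : i = k <;> simp [betaOf, inputOf, h, zeroZero]

variable {j k}

/-- Only `U` at `j` and `V` at `k` are nontrivial; they diagonalize the two outer ends of the chain,
and `V` alone contributes a sign. -/
theorem pauliCov_layerUV (hjk : j < k) :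
    PauliCov (layerUV (inputOf j k (code s) (code t))) (stabBell j k s t) (stabUV j k s t)
      (sgn (decide (t = 2))) := by
  have := PauliCov.layer (g := fun i : Fin n =>
    onQubits ![(0, i, 0), (0, i, 1)] (gateU (if i = j then code s else zeroZero)) *
    onQubits ![(1, i, 0), (1, i, 1)] (gateV (if i = k then code t else zeroZero)))
    (c := fun i => 1 * if i = k then sgn (decide (t = 2)) else 1)
    (f := stabBell j k s t) (f' := stabUV j k s t) posBlock posBlock_disjoint ?_ ?_
  · simpa [layerUV, alphaOf_inputOf, betaOf_inputOf] using this
  · intro i h h' hh hh' hne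
    refine PauliCov.onQubits_mul_onQubits (e := ![((0, i, 0) : Idx n), (0, i, 1)]) (f := h)
      (f' := h') (e' := ![((1, i, 0) : Idx n), (1, i, 1)])
      (by intro x y; fin_cases x <;> fin_cases y <;> simp)
      (by intro x y; fin_cases x <;> fin_cases y <;> simp)
      (by intro x y; fin_cases x <;> fin_cases y <;> simp) ?_ ?_ ?_
    · have e : ∀ m : PauliString (Idx n),
          (fun b => m (![((0, i, 0) : Idx n), (0, i, 1)] b)) = fun b => m (0, i, b) := fun m => by
        funext b; fin_cases b <;> rfl
      have e1 : (fun b => h (0, i, b)) = fun b => stabBell j k s t (0, i, b) :=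
        funext fun b => hh _ rfl
      have e2 : (fun b => h' (0, i, b)) = fun b => stabUV j k s t (0, i, b) :=
        funext fun b => hh' _ rfl
      rw [e, e, e1, e2]
      split_ifs with hi
      · subst hi
        simpa [stabBell, stabUV, hjk.le] using pauliCov_gateU s t
      · rw [show gateU zeroZero = 1 from rfl]
        simpa [stabUV, hi] using PauliCov.one (Q := Fin 2) _
    · have e : ∀ m : PauliString (Idx n),
          (fun b => m (![((1, i, 0) : Idx n), (1, i, 1)] b)) = fun b => m (1, i, b) := fun m => by
        funext b; fin_cases b <;> rfl
      have e1 : (fun b => h (1, i, b)) = fun b => stabBell j k s t (1, i, b) :=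
        funext fun b => hh _ rfl
      have e2 : (fun b => h' (1, i, b)) = fun b => stabUV j k s t (1, i, b) :=
        funext fun b => hh' _ rfl
      rw [e, e, e1, e2]
      split_ifs with hi
      · subst hi
        simpa [stabBell, stabUV, hjk.le] using pauliCov_gateV s t
      · rw [show gateV zeroZero = 1 from rfl]
        simpa [stabUV, hi] using PauliCov.one (Q := Fin 2) _
    · rintro ⟨a, i', b⟩ hq hq'
      by_cases hi : i' = i
      · subst hi
        fin_cases a <;> fin_cases b
        · exact absurd ⟨0, rfl⟩ hq
        · exact absurd ⟨1, rfl⟩ hq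
        · exact absurd ⟨0, rfl⟩ hq'
        · exact absurd ⟨1, rfl⟩ hq'
      · exact hne _ hi
  · exact fun q hq => absurd rfl (hq q.2.1)

/-- The qubits acted upon by the gate `W` at a position. -/
def linkBlock (i : Fin n) : Set (Idx n) :=
  {q | i.val + 1 < n ∧ ((q.1 = 1 ∧ q.2.1 = i) ∨ (q.1 = 0 ∧ q.2.1.val = i.val + 1))}

theorem linkBlock_disjoint (i i' : Fin n) (q : Idx n) (h : q ∈ linkBlock i)
    (h' : q ∈ linkBlock i') : i = i' := by
  obtain ⟨-, ⟨h1, h2⟩ | ⟨h1, h2⟩⟩ := h <;> obtain ⟨-, ⟨h3, h4⟩ | ⟨h3, h4⟩⟩ := h'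
  · exact h2.symm.trans h4
  · rw [h1] at h3; exact absurd h3 (by decide)
  · rw [h1] at h3; exact absurd h3 (by decide)
  · exact Fin.ext (by omega)

/-- Every link inside the chain carries the same Pauli on its two ends and is diagonalized by the
Bell measurements. The links entering `j` and leaving `k` have `W = I`, because `α_j` and `β_k` are
nonzero; their qubits are already `Z`-type or trivial. -/
theorem pauliCov_layerW (hjk : j < k) :
    PauliCov (layerW (inputOf j k (code s) (code t))) (stabUV j k s t)
      (fun q => (false, check j k s t q)) 1 := by
  have := PauliCov.layer (g := fun i : Fin n =>
    if h : i.val + 1 < n then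
      onQubits ![(1, i, 0), (1, i, 1), (0, ⟨i.val + 1, h⟩, 0), (0, ⟨i.val + 1, h⟩, 1)]
        (gateW (if i = k then code t else zeroZero)
          (if (⟨i.val + 1, h⟩ : Fin n) = j then code s else zeroZero))
    else 1) (c := fun _ => 1)
    (f := stabUV j k s t) (f' := fun q => (false, check j k s t q))
    linkBlock linkBlock_disjoint ?_ ?_
  · simpa [layerW, alphaOf_inputOf, betaOf_inputOf] using this
  · intro i h h' hh hh' hne
    by_cases hi : i.val + 1 < n
    · rw [dif_pos hi]
      refine PauliCov.onQubits (by intro x y; fin_cases x <;> fin_cases y <;> simp) ?_ ?_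
      · have m1 : ∀ b, ((1, i, b) : Idx n) ∈ linkBlock i := fun b => ⟨hi, Or.inl ⟨rfl, rfl⟩⟩
        have m0 : ∀ b, ((0, ⟨i.val + 1, hi⟩, b) : Idx n) ∈ linkBlock i :=
          fun b => ⟨hi, Or.inr ⟨rfl, rfl⟩⟩
        have e1 := fun b => hh _ (m1 b)
        have e0 := fun b => hh _ (m0 b)
        have e1' := fun b => hh' _ (m1 b)
        have e0' := fun b => hh' _ (m0 b)
        by_cases hik : i = k
        · subst hik
          have : gateW (code t) (if (⟨i.val + 1, hi⟩ : Fin n) = j then code s else zeroZero) = 1 :=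
            if_neg fun h => code_ne_zeroZero t h.2
          rw [if_pos rfl, this]
          convert PauliCov.one _ using 1
          have hj : (⟨i.val + 1, hi⟩ : Fin n) ≠ j := by
            rintro rfl; exact absurd hjk (by simp [Fin.lt_def])
          funext b
          fin_cases b <;> simp [e1, e0, e1', e0', stabUV, stabBell, check, hj, Fin.le_def]
        · by_cases hij : (⟨i.val + 1, hi⟩ : Fin n) = j
          · have : gateW (if i = k then code t else zeroZero) (code s) = 1 :=
              if_neg fun h => code_ne_zeroZero s h.1
            rw [if_pos hij, this]
            convert PauliCov.one _ using 1
            have hj : ¬ j ≤ i := by rw [← hij]; simp [Fin.le_def]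
            funext b
            fin_cases b <;> simp [e1, e0, e1', e0'] <;>
              simp [stabUV, stabBell, check, hij, hik, hj]
          · rw [if_neg hij, if_neg hik]
            -- Away from the two boundary links, both ends of a link lie in the chain or neither
            -- does.
            have h1 : (j ≤ (⟨i.val + 1, hi⟩ : Fin n) ∧ (⟨i.val + 1, hi⟩ : Fin n) ≤ k) ↔
                (j ≤ i ∧ i ≤ k) := by
              simp only [Fin.le_def, Fin.ext_iff] at *; omega
            apply pauliCov_gateW <;>
              simp [e1, e0, e1', e0', stabUV, stabBell, check, hij, hik, h1] <;>
              split_ifs <;> simp <;> tauto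
      · rintro ⟨a, i', b⟩ hq
        apply hne
        rintro ⟨-, ⟨h1, h2⟩ | ⟨h1, h2⟩⟩
        · dsimp only at h1 h2; subst h1 h2
          fin_cases b
          · exact hq ⟨0, rfl⟩
          · exact hq ⟨1, rfl⟩
        · obtain rfl : i' = ⟨i.val + 1, hi⟩ := Fin.ext h2
          dsimp only at h1; subst h1
          fin_cases b
          · exact hq ⟨2, rfl⟩
          · exact hq ⟨3, rfl⟩
    · rw [dif_neg hi]
      obtain rfl : h = h' := funext fun q => hne q fun hq => hi hq.1
      exact PauliCov.one h
  -- The qubits on no link are the left ones of the first position and the right ones of the last.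
  -- Each is an outer end of the chain, hence `Z`-type, or lies outside the chain.
  · rintro ⟨a, i, b⟩ hq
    fin_cases a
    · by_cases hj : i = j
      · simp [stabUV, check, hj]
      · have : ¬ (j ≤ i ∧ i ≤ k) := by
          rintro ⟨h1, h2⟩
          have h1 := Fin.le_def.1 h1
          have h3 : j.val ≠ i.val := fun h => hj (Fin.ext h.symm)
          refine hq ⟨i.val - 1, by omega⟩ ⟨?_, Or.inr ⟨rfl, ?_⟩⟩ <;>
          · dsimp only; omega
        simp [stabUV, stabBell, check, hj, this]
    · by_cases hk : i = k
      · simp [stabUV, check, hk]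
      · have : ¬ (j ≤ i ∧ i ≤ k) := by
          rintro ⟨h1, h2⟩
          have h1 := Fin.le_def.1 h2
          have h3 : k.val ≠ i.val := fun h => hk (Fin.ext h.symm)
          exact hq i ⟨by omega, Or.inl ⟨rfl, rfl⟩⟩
        simp [stabUV, stabBell, check, hk, this]

/-- The parity constraint satisfied by every solution. -/
theorem Relation.parity (hjk : j < k) {zout : Idx n → Bool}
    (h : Relation (inputOf j k (code s) (code t)) zout) :
    sgn (decide (t = 2)) * ∏ q, sgn (check j k s t q && zout q) = 1 := by
  have hC : PauliCov (circuitUnitary (inputOf j k (code s) (code t))) (stabInit j k s t)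
      (fun q => (false, check j k s t q)) (sgn (decide (t = 2))) := by
    simpa [circuitUnitary] using (((pauliCov_layerW s t hjk).mul (pauliCov_layerUV s t hjk)).mul
      (pauliCov_layerCNOT j k s t)).mul (pauliCov_layerH j k s t)
  have h0 : circuitUnitary (inputOf j k (code s) (code t)) zout (fun _ => false) ≠ 0 := by
    intro h0
    simp [Relation, h0] at h
  -- The final string shifts nothing and the initial one has phase 1 on the all-zero state, so
  -- covariance equates the amplitude with itself times the sign of the constraint.
  have := hC zout (fun _ => false)
  have e1 : PauliString.shift (fun q => (false, check j k s t q)) zout = zout := by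
    funext q; simp [PauliString.shift]
  have e2 : (stabInit j k s t).shift (fun _ => false) = fun _ => false := by
    funext q; simp [PauliString.shift, stabInit]
  have e3 : (stabInit j k s t).phase (fun _ => false) = 1 := by
    simp [PauliString.phase]
  rw [e1, e2, e3, mul_one] at this
  exact mul_right_cancel₀ h0 (this.symm.trans (one_mul _).symm)

end Propagation

end MagicSquare

/-! ## Light cones -/

namespace ClassicalCircuit

variable {I O : Type} (C : ClassicalCircuit I O)

theorem exists_pathFromInput (v : C.V) : ∃ m, C.PathFromInput v m := by
  induction v using C.wellFounded_edge.induction with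
  | _ v ih =>
    by_cases h : C.fanIn v = 0
    · exact ⟨0, .input v h⟩
    · obtain ⟨m, hm⟩ := ih (C.pred v ⟨0, Nat.pos_of_ne_zero h⟩) ⟨_, rfl⟩
      exact ⟨m + 1, .gate v _ m hm⟩

/-- A vertex reached by paths with at most `d` gates only depends on `K ^ d` input bits. -/
theorem exists_lightcone {K : ℕ} (hK1 : 1 ≤ K) (hK : C.FanInAtMost K) (d : ℕ) (v : C.V)
    (hv : ∀ m, C.PathFromInput v m → m ≤ d) : ∃ L : Finset I, L.card ≤ K ^ d ∧
      ∀ x x' : I → Bool, (∀ i ∈ L, x i = x' i) → C.value x v = C.value x' v := by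
  classical
  have input : ∀ v, C.fanIn v = 0 → ∃ L : Finset I, L.card = 1 ∧
      ∀ x x' : I → Bool, (∀ i ∈ L, x i = x' i) → C.value x v = C.value x' v := by
    intro v h
    refine ⟨{C.inputs.symm ⟨v, h⟩}, by simp, fun x x' hx => ?_⟩
    have hv := C.inputs.apply_symm_apply ⟨v, h⟩
    have h1 := C.value_input x (C.inputs.symm ⟨v, h⟩)
    have h2 := C.value_input x' (C.inputs.symm ⟨v, h⟩)
    rw [hv] at h1 h2
    rw [h1, h2]
    exact hx _ (by simp)
  induction d generalizing v with
  | zero =>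
    have h : C.fanIn v = 0 := by
      by_contra h
      obtain ⟨m, hm⟩ := C.exists_pathFromInput (C.pred v ⟨0, Nat.pos_of_ne_zero h⟩)
      exact absurd (hv _ (.gate v _ m hm)) (by omega)
    obtain ⟨L, hL, hL'⟩ := input v h
    exact ⟨L, by simp [hL], hL'⟩
  | succ d ih =>
    by_cases h : C.fanIn v = 0
    · obtain ⟨L, hL, hL'⟩ := input v h
      exact ⟨L, hL.trans_le (Nat.one_le_pow _ _ hK1), hL'⟩
    · choose L hL hL' using fun i => ih (C.pred v i) fun m hm =>
        Nat.le_of_succ_le_succ (hv _ (.gate v i m hm))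
      refine ⟨Finset.univ.biUnion L, ?_, fun x x' hx => ?_⟩
      · calc (Finset.univ.biUnion L).card ≤ (Finset.univ : Finset (Fin (C.fanIn v))).card * K ^ d :=
              Finset.card_biUnion_le_card_mul _ _ _ fun i _ => hL i
          _ ≤ K ^ (d + 1) := by
              rw [Finset.card_univ, Fintype.card_fin, pow_succ']
              exact Nat.mul_le_mul_right _ (hK v)
      · rw [C.value_gate x v h, C.value_gate x' v h]
        congr 1
        funext i
        exact hL' i x x' fun a ha => hx a (Finset.mem_biUnion.2 ⟨i, Finset.mem_univ _, ha⟩)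

theorem pathFromInput_le_depth (o : O) {m : ℕ} (h : C.PathFromInput (C.outputs o).1 m) :
    m ≤ C.depth := le_csSup C.bddAbove_paths ⟨o, h⟩

end ClassicalCircuit

/-- Each output bit of a probabilistic circuit only depends on few bits of the instance. -/
theorem ProbabilisticCircuit.exists_lightcone {I O : Type} (C : ProbabilisticCircuit I O) {K : ℕ}
    (hK1 : 1 ≤ K) (hK : C.circuit.FanInAtMost K) (o : O) :
    ∃ L : Finset I, L.card ≤ K ^ C.circuit.depth ∧
      ∀ ρ z z', (∀ i ∈ L, z i = z' i) → C.run z ρ o = C.run z' ρ o := by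
  obtain ⟨L, hL, hL'⟩ := C.circuit.exists_lightcone hK1 hK C.circuit.depth
    (C.circuit.outputs (Sum.inl o)).1 fun m hm => C.circuit.pathFromInput_le_depth _ hm
  -- The random bits are held at `ρ`, so only the instance bits of the light cone matter.
  refine ⟨L.preimage Sum.inl Sum.inl_injective.injOn, ?_, fun ρ z z' h => hL' _ _ ?_⟩
  · exact (Finset.card_le_card_of_injOn Sum.inl (fun i hi => Finset.mem_preimage.1 hi)
      Sum.inl_injective.injOn).trans hL
  · rintro (i | i) hi
    · exact h i (Finset.mem_preimage.2 hi)
    · rfl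

namespace MagicSquare

/-! ## No local strategy wins the magic square game -/

/-- The Paulis in a row multiply to the identity up to sign, and the three forms sum to zero, so for
fixed `s` such a bit enters an even number of the three checks. The bits of `y_k` are excluded
because they enter through `form s`, which does not vary with `t`. -/
theorem prod_sgn_check_row {n : ℕ} (j k : Fin n) (s : Fin 3) (w : Bool) (q : Idx n)
    (hq : ¬ (q.1 = 1 ∧ q.2.1 = k)) : ∏ t, sgn (check j k s t q && w) = 1 := by
  obtain ⟨a, i, b⟩ := q
  cases w
  · simp
  · have h1 : ∏ t, sgn (form t b) = 1 := by
      fin_cases b <;> simp [Fin.prod_univ_three, form]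
    have h2 : ∏ t, sgn (squarePauli s t b).1 = 1 := by
      fin_cases s <;> fin_cases b <;> simp [Fin.prod_univ_three, squarePauli]
    have h3 : ∏ t, sgn (squarePauli s t b).2 = 1 := by
      fin_cases s <;> fin_cases b <;> simp [Fin.prod_univ_three, squarePauli]
    simp only [check, Bool.and_true]
    split_ifs <;> simp_all
    omega

theorem prod_sgn_check_col {n : ℕ} (j k : Fin n) (t : Fin 3) (w : Bool) (q : Idx n)
    (hq : ¬ (q.1 = 0 ∧ q.2.1 = j)) : ∏ s, sgn (check j k s t q && w) = 1 := by
  obtain ⟨a, i, b⟩ := q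
  cases w
  · simp
  · have h1 : ∏ s, sgn (form s b) = 1 := by
      fin_cases b <;> simp [Fin.prod_univ_three, form]
    have h2 : ∏ s, sgn (squarePauli s t b).1 = 1 := by
      fin_cases t <;> fin_cases b <;> simp [Fin.prod_univ_three, squarePauli]
    have h3 : ∏ s, sgn (squarePauli s t b).2 = 1 := by
      fin_cases t <;> fin_cases b <;> simp [Fin.prod_univ_three, squarePauli]
    simp only [check, Bool.and_true]
    split_ifs <;> simp_all

/-- In the product of the nine parity constraints each output bit cancels, along rows if it depends
only on `s` and along columns if only on `t`. The signs of the last column leave `(-1)^3`. -/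
theorem not_forall_relation {n : ℕ} {j k : Fin n} (hjk : j < k)
    (out : Fin 3 → Fin 3 → Idx n → Bool)
    (hdep : ∀ q, (∀ s t t', out s t q = out s t' q) ∨ (∀ s s' t, out s t q = out s' t q))
    (hA : ∀ b s t t', out s t (0, j, b) = out s t' (0, j, b))
    (hB : ∀ b s s' t, out s t (1, k, b) = out s' t (1, k, b)) :
    ¬ ∀ s t, Relation (inputOf j k (code s) (code t)) (out s t) := by
  intro h
  have row : ∀ q, ¬ (q.1 = 1 ∧ q.2.1 = k) → (∀ s t t', out s t q = out s t' q) →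
      ∏ s, ∏ t, sgn (check j k s t q && out s t q) = 1 := by
    intro q hq ho
    refine Finset.prod_eq_one fun s _ => ?_
    rw [← prod_sgn_check_row j k s (out s 0 q) q hq]
    exact Finset.prod_congr rfl fun t _ => by rw [ho s t 0]
  have col : ∀ q, ¬ (q.1 = 0 ∧ q.2.1 = j) → (∀ s s' t, out s t q = out s' t q) →
      ∏ s, ∏ t, sgn (check j k s t q && out s t q) = 1 := by
    intro q hq ho
    rw [Finset.prod_comm]
    refine Finset.prod_eq_one fun t _ => ?_
    rw [← prod_sgn_check_col j k t (out 0 t q) q hq]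
    exact Finset.prod_congr rfl fun s _ => by rw [ho s 0 t]
  have all : ∀ q, ∏ s, ∏ t, sgn (check j k s t q && out s t q) = 1 := by
    rintro ⟨a, i, b⟩
    by_cases h1 : a = 1 ∧ i = k
    · obtain ⟨rfl, rfl⟩ := h1
      exact col _ (by simp) (hB b)
    · by_cases h0 : a = 0 ∧ i = j
      · obtain ⟨rfl, rfl⟩ := h0
        exact row _ (by simp) (hA b)
      · exact (hdep (a, i, b)).elim (row _ h1) (col _ h0)
  have key : ∏ s, ∏ t, (sgn (decide (t = 2)) * ∏ q, sgn (check j k s t q && out s t q)) = 1 :=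
    Finset.prod_eq_one fun s _ => Finset.prod_eq_one fun t _ => (h s t).parity s t hjk
  have comm : ∏ s, ∏ t, ∏ q, sgn (check j k s t q && out s t q) = 1 := by
    simp_rw [Finset.prod_comm (s := (Finset.univ : Finset (Fin 3))) (t := Finset.univ (α := Idx n))]
    exact Finset.prod_eq_one fun q _ => all q
  simp only [Finset.prod_mul_distrib, comm, mul_one] at key
  simp [Fin.prod_univ_three] at key
  norm_num at key

/-! ## Counting -/

section Counting

variable {n : ℕ} (L : Idx n → Finset (Idx n))

/-- The positions `j`, `k` are independent with respect to the light cones `L`: no output bit sees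
both `α_j` and `β_k`, no bit of `x_j` sees `β_k`, and no bit of `y_k` sees `α_j`. -/
def Separated (j k : Fin n) : Prop :=
  (∀ o, (∀ b, (1, k, b) ∉ L o) ∨ (∀ b, (0, j, b) ∉ L o)) ∧
    (∀ b b', (1, k, b') ∉ L (0, j, b)) ∧ ∀ b b', (0, j, b') ∉ L (1, k, b)

-- Union bound over the `4n` output bits: `B1` collects pairs seen by a common output, `B2` and `B3`
-- pairs in which an output at one position sees an input at the other. Each has at most `4 n M²`
-- elements.
open Classical in
theorem card_not_separated_le {M : ℕ} (hL : ∀ o, (L o).card ≤ M) :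
    (Finset.univ.filter fun p : Fin n × Fin n => ¬ Separated L p.1 p.2).card ≤
      12 * n * M ^ 2 := by
  have hcard : (Finset.univ : Finset (Idx n)).card = 4 * n := by
    simp [Finset.card_univ]; ring
  let B1 : Finset (Fin n × Fin n) := Finset.univ.biUnion fun o =>
    (L o ×ˢ L o).image fun p => (p.1.2.1, p.2.2.1)
  let B2 : Finset (Fin n × Fin n) := Finset.univ.biUnion fun o : Idx n =>
    (L o).image fun p => (o.2.1, p.2.1)
  let B3 : Finset (Fin n × Fin n) := Finset.univ.biUnion fun o : Idx n =>
    (L o).image fun p => (p.2.1, o.2.1)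
  have hMM : M ≤ M ^ 2 := Nat.le_self_pow (by norm_num) M
  have h1 : B1.card ≤ 4 * n * M ^ 2 := by
    rw [← hcard]
    refine Finset.card_biUnion_le_card_mul _ _ _ fun o _ => Finset.card_image_le.trans ?_
    rw [Finset.card_product, sq]
    exact Nat.mul_le_mul (hL o) (hL o)
  have h2 : B2.card ≤ 4 * n * M ^ 2 := by
    rw [← hcard]
    exact Finset.card_biUnion_le_card_mul _ _ _ fun o _ =>
      Finset.card_image_le.trans ((hL o).trans hMM)
  have h3 : B3.card ≤ 4 * n * M ^ 2 := by
    rw [← hcard]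
    exact Finset.card_biUnion_le_card_mul _ _ _ fun o _ =>
      Finset.card_image_le.trans ((hL o).trans hMM)
  have hsub : (Finset.univ.filter fun p : Fin n × Fin n => ¬ Separated L p.1 p.2) ⊆
      B1 ∪ B2 ∪ B3 := by
    rintro ⟨j, k⟩ hp
    contrapose! hp
    simp only [Finset.mem_union, not_or] at hp
    simp only [Finset.mem_filter, Finset.mem_univ, true_and, not_not]
    refine ⟨fun o => ?_, fun b b' h => hp.1.2 ?_, fun b b' h => hp.2 ?_⟩
    · by_contra! hc
      obtain ⟨⟨b, hb⟩, b', hb'⟩ := hc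
      exact hp.1.1 (Finset.mem_biUnion.2 ⟨o, Finset.mem_univ _, Finset.mem_image.2
        ⟨((0, j, b'), (1, k, b)), Finset.mem_product.2 ⟨hb', hb⟩, rfl⟩⟩)
    · exact Finset.mem_biUnion.2 ⟨_, Finset.mem_univ _, Finset.mem_image.2 ⟨_, h, rfl⟩⟩
    · exact Finset.mem_biUnion.2 ⟨_, Finset.mem_univ _, Finset.mem_image.2 ⟨_, h, rfl⟩⟩
  have := Finset.card_le_card hsub
  have := Finset.card_union_le (B1 ∪ B2) B3
  have := Finset.card_union_le B1 B2
  linarith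

/-- Varying `t` changes only the bits of `β_k`, and varying `s` only those of `α_j`; separation thus
supplies the dependence hypotheses of `not_forall_relation`. -/
theorem not_forall_relation_of_separated {j k : Fin n} (hjk : j < k) (hs : Separated L j k)
    (F : (Idx n → Bool) → Idx n → Bool)
    (hF : ∀ o z z', (∀ i ∈ L o, z i = z' i) → F z o = F z' o) :
    ¬ ∀ s t, Relation (inputOf j k (code s) (code t)) (F (inputOf j k (code s) (code t))) := by
  have hα : ∀ o, (∀ b, (1, k, b) ∉ L o) → ∀ s t t',
      F (inputOf j k (code s) (code t)) o = F (inputOf j k (code s) (code t')) o := by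
    refine fun o ho s t t' => hF o _ _ ?_
    rintro ⟨a, i, b⟩ hi
    fin_cases a
    · rfl
    · have : i ≠ k := by rintro rfl; exact ho b hi
      simp [inputOf, this]
  have hβ : ∀ o, (∀ b, (0, j, b) ∉ L o) → ∀ s s' t,
      F (inputOf j k (code s) (code t)) o = F (inputOf j k (code s') (code t)) o := by
    refine fun o ho s s' t => hF o _ _ ?_
    rintro ⟨a, i, b⟩ hi
    fin_cases a
    · have : i ≠ j := by rintro rfl; exact ho b hi
      simp [inputOf, this]
    · rfl
  exact not_forall_relation hjk (fun s t => F (inputOf j k (code s) (code t)))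
    (fun q => (hs.1 q).imp (hα q) (hβ q)) (fun b => hα _ (hs.2.1 b)) (fun b => hβ _ (hs.2.2 b))

/-- The pairs of positions `j < k`. -/
def posPairs (n : ℕ) : Finset (Fin n × Fin n) := Finset.univ.filter fun p => p.1 < p.2

theorem card_posPairs (n : ℕ) : (posPairs n).card * 2 = n * (n - 1) := by
  rw [← Finset.sum_range_id_mul_two, posPairs, Finset.card_filter, Fintype.sum_prod_type_right,
    Finset.sum_range]
  congr 1
  refine Finset.sum_congr rfl fun k _ => ?_
  simp [Finset.filter_gt_eq_Iio]

/-- The input with given positions and codes of the nonzero strings. -/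
def codedInput (p : (Fin n × Fin n) × (Fin 3 × Fin 3)) : Idx n → Bool :=
  inputOf p.1.1 p.1.2 (code p.2.1) (code p.2.2)

theorem codedInput_injective : Function.Injective (codedInput (n := n)) := by
  rintro ⟨⟨j, k⟩, s, t⟩ ⟨⟨j', k'⟩, s', t'⟩ h
  have hex : ∀ s, ∃ b, code s b = true := by decide
  have h0 : ∀ i b, (if i = j then code s b else false) = if i = j' then code s' b else false :=
    fun i b => congrFun h (0, i, b)
  have h1 : ∀ i b, (if i = k then code t b else false) = if i = k' then code t' b else false :=
    fun i b => congrFun h (1, i, b)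
  obtain rfl : j = j' := by
    obtain ⟨b, hb⟩ := hex s
    by_contra hne
    have := h0 j b
    simp [hne, hb] at this
  obtain rfl : k = k' := by
    obtain ⟨b, hb⟩ := hex t
    by_contra hne
    have := h1 k b
    simp [hne, hb] at this
  obtain rfl : s = s' := code_injective (funext fun b => by simpa using h0 j b)
  obtain rfl : t = t' := code_injective (funext fun b => by simpa using h1 k b)
  rfl

theorem inputSet_eq : inputSet n = ((posPairs n) ×ˢ Finset.univ).map
    ⟨codedInput, codedInput_injective⟩ := by
  ext z
  simp only [inputSet, posPairs, Finset.mem_filter, Finset.mem_univ, true_and, Finset.mem_map,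
    Finset.mem_product, and_true, Function.Embedding.coeFn_mk, Prod.exists]
  constructor
  · rintro ⟨j, k, α, β, hjk, hα, hβ, rfl⟩
    obtain ⟨s, rfl⟩ := exists_code_eq hα
    obtain ⟨t, rfl⟩ := exists_code_eq hβ
    exact ⟨j, k, s, t, hjk, rfl⟩
  · rintro ⟨j, k, s, t, hjk, rfl⟩
    exact ⟨j, k, _, _, hjk, code_ne_zeroZero s, code_ne_zeroZero t, rfl⟩

open Classical in
/-- A function with small light cones fails on at least one input for each separated pair. -/
theorem card_solved_le {M : ℕ} (hL : ∀ o, (L o).card ≤ M)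
    (F : (Idx n → Bool) → Idx n → Bool)
    (hF : ∀ o z z', (∀ i ∈ L o, z i = z' i) → F z o = F z' o) :
    ((inputSet n).filter fun z => Relation z (F z)).card ≤
      8 * (posPairs n).card + 12 * n * M ^ 2 := by
  rw [inputSet_eq, Finset.filter_map, Finset.card_map, Finset.card_filter, Finset.sum_product]
  -- Of the nine inputs for a pair, at most 8 are solved if it is separated; otherwise the trivial
  -- bound 9 is written as `8 + 1`.
  have hp : ∀ p ∈ posPairs n, (∑ q : Fin 3 × Fin 3, if ((fun z => Relation z (F z)) ∘
      (⟨codedInput, codedInput_injective⟩ : _ ↪ (Idx n → Bool))) (p, q) then 1 else 0) ≤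
        8 + if ¬ Separated L p.1 p.2 then 1 else 0 := by
    intro p hp
    rw [← Finset.card_filter]
    by_cases hs : Separated L p.1 p.2
    · have := not_forall_relation_of_separated L (Finset.mem_filter.1 hp).2 hs F hF
      push Not at this
      obtain ⟨s, t, hst⟩ := this
      have hlt := Finset.card_lt_card (Finset.filter_ssubset.2
        ⟨(s, t), Finset.mem_univ (s, t), hst⟩ : (Finset.univ.filter fun q : Fin 3 × Fin 3 =>
          ((fun z => Relation z (F z)) ∘
            (⟨codedInput, codedInput_injective⟩ : _ ↪ (Idx n → Bool))) (p, q)) ⊂ Finset.univ)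
      have h9 : (Finset.univ : Finset (Fin 3 × Fin 3)).card = 9 := rfl
      rw [h9] at hlt
      simpa [hs] using Nat.le_of_lt_succ hlt
    · simpa [hs] using Finset.card_filter_le (Finset.univ : Finset (Fin 3 × Fin 3)) _
  refine (Finset.sum_le_sum hp).trans ?_
  rw [Finset.sum_add_distrib, Finset.sum_const, smul_eq_mul, mul_comm, ← Finset.card_filter]
  refine Nat.add_le_add_left (le_trans (Finset.card_le_card ?_) (card_not_separated_le L hL)) _
  exact Finset.filter_subset_filter _ (Finset.subset_univ _)

end Counting

end MagicSquare

/-! ### Averaging over the random bits and the final estimate -/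

open Classical in
/-- The success probability is bounded by the best success count over the random bits. -/
theorem ProbabilisticCircuit.successProb_mul_card_le {I O : Type}
    (C : ProbabilisticCircuit I O) {S : Finset (I → Bool)} (hS : S.Nonempty)
    (R : (I → Bool) → (O → Bool) → Prop) (B : ℝ)
    (hB : ∀ ρ, ((S.filter fun z => R z (C.run z ρ)).card : ℝ) ≤ B) :
    C.successProb S R * S.card ≤ B := by
  have hS' : (S.card : ℝ) ≠ 0 := by exact_mod_cast hS.card_pos.ne'
  have hsum : ∑ ρ, (C.randomness ρ).toReal = 1 := by
    rw [← ENNReal.toReal_sum fun ρ _ => C.randomness.apply_ne_top ρ,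
      ← tsum_fintype (L := .unconditional _), C.randomness.tsum_coe, ENNReal.toReal_one]
  rw [ProbabilisticCircuit.successProb, div_mul_cancel₀ _ hS', Finset.sum_comm]
  calc _ ≤ ∑ ρ, (C.randomness ρ).toReal * B := Finset.sum_le_sum fun ρ _ => ?_
    _ = B := by rw [← Finset.sum_mul, hsum, one_mul]
  rw [← Finset.sum_filter, Finset.sum_const, nsmul_eq_mul, mul_comm]
  exact mul_le_mul_of_nonneg_left (hB ρ) ENNReal.toReal_nonneg

theorem mainTheorem3 (n K : ℕ) (hn : 2 ≤ n) (hK : 2 ≤ K)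
    (C : ProbabilisticCircuit (MagicSquare.Idx n) (MagicSquare.Idx n))
    (hfan : C.circuit.FanInAtMost K)
    (hsucc : 9 / 10 ≤ C.successProb (MagicSquare.inputSet n) MagicSquare.Relation) :
    Real.log (0.00001 * (n : ℝ)) / (2 * Real.log (K : ℝ)) ≤ (C.circuit.depth : ℝ) := by
  classical
  choose L hL hL' using fun o => C.exists_lightcone (by omega : 1 ≤ K) hfan o
  set M := K ^ C.circuit.depth with hM
  have hpairs : ((MagicSquare.posPairs n).card : ℝ) * 2 = n * (n - 1) := by
    have := MagicSquare.card_posPairs n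
    rw [← Nat.cast_pred (by omega : 0 < n)]
    exact_mod_cast this
  have hn' : (2 : ℝ) ≤ n := by exact_mod_cast hn
  have hcard : ((MagicSquare.inputSet n).card : ℝ) = (MagicSquare.posPairs n).card * 9 := by
    rw [MagicSquare.inputSet_eq, Finset.card_map, Finset.card_product]
    simp
  have hS : (MagicSquare.inputSet n).Nonempty := by
    rw [← Finset.card_pos]
    have : (0 : ℝ) < (MagicSquare.inputSet n).card := by rw [hcard]; nlinarith
    exact_mod_cast this
  have hle := C.successProb_mul_card_le hS MagicSquare.Relation
    (8 * (MagicSquare.posPairs n).card + 12 * n * M ^ 2) fun ρ => by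
      exact_mod_cast MagicSquare.card_solved_le L hL (fun z => C.run z ρ) fun o => hL' o ρ
  have hlow := (mul_le_mul_of_nonneg_right hsucc (Nat.cast_nonneg _)).trans hle
  rw [hcard] at hlow
  -- There are `9 n(n-1)/2` inputs, so `(81/10 - 8) n(n-1)/2 ≤ 12 n M²`; dividing by `n/20` gives
  -- 240.
  have hbound : (n : ℝ) - 1 ≤ 240 * (M : ℝ) ^ 2 := by
    refine le_of_mul_le_mul_left (a := (n : ℝ)) ?_ (by linarith)
    linarith
  -- As `n ≥ 2`, one has `n ≤ 2(n-1) ≤ 480 M²`, so the constant `10⁻⁵` leaves ample room.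
  have hfin : 0.00001 * (n : ℝ) ≤ (K : ℝ) ^ (2 * C.circuit.depth) := by
    have : (M : ℝ) ^ 2 = (K : ℝ) ^ (2 * C.circuit.depth) := by
      rw [hM]; push_cast; rw [← pow_mul, mul_comm]
    rw [← this]
    norm_num
    linarith
  have hlog : 0 < Real.log (K : ℝ) := Real.log_pos (by exact_mod_cast (by omega : 1 < K))
  rw [div_le_iff₀ (by positivity)]
  have := Real.log_le_log (by positivity) hfin
  rw [Real.log_pow] at this
  push_cast at this
  linarith

end
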